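/- A hypergraph $\mathcal H=(V,\mathcal E)$ has a vertex set $V$ and a set $\mathcal E$ (without repetitions) of subsets of $V$ as hyperedges. Its edge intersection hypergraph $EI(\mathcal H)$ has the same vertex set $V$ and the hyperedge set $$\{\,e_1\cap e_2 \;:\; e_1,e_2\in\mathcal E,\ e_1\neq e_2,\ |e_1\cap e_2|\ge 2\,\}.$$ The hypergraph $\mathcal H$ is $k$-uniform if every hyperedge has cardinality $k$, and $r$-regular if every vertex lies in exactly $r$ hyperedges. Let $C_n$ denote the cycle with $n$ vertices, regarded as a 2-uniform hypergraph. Theorem. Let $n\ge 24$. Then there exists a hypergraph $\mathcal H=(V,\mathcal E)$ with $EI(\mathcal H)=C_n$ such that the following holds. (i) If $n$ is even, then $\mathcal H$ is 3-regular, 6-uniform and $|\mathcal E|=\frac n2$. (ii) If $n$ is odd, then $\mathcal H$ is 3-regular, $|\mathcal E|=\frac{n+1}2$, $\mathcal H$ contains exactly one hyperedge of cardinality 3, and all other hyperedges of $\mathcal H$ have cardinality 6. -/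

import Mathlib

namespace Hypergraph

/-- The edge intersection hypergraph `EI(H)`: the same vertices as `H`, and as hyperedges all
intersections with at least two elements of two distinct hyperedges of `H`. -/
def edgeIntersection {α : Type*} (H : Hypergraph α) : Hypergraph α where
  vertexSet := H.vertexSet
  edgeSet := {e | ∃ e₁ ∈ H.edgeSet, ∃ e₂ ∈ H.edgeSet,
    e₁ ≠ e₂ ∧ 2 ≤ (e₁ ∩ e₂).encard ∧ e = e₁ ∩ e₂}
  subset_vertexSet_of_mem_edgeSet' := by
    rintro e ⟨e₁, h₁, e₂, -, -, -, rfl⟩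
    exact Set.inter_subset_left.trans (H.subset_vertexSet_of_mem_edgeSet' h₁)

/-- The degree of a vertex: the number of hyperedges incident to it. -/
noncomputable def degree {α : Type*} (H : Hypergraph α) (v : α) : ℕ∞ :=
  {e | e ∈ H.edgeSet ∧ v ∈ e}.encard

/-- A hypergraph is `r`-regular if all its vertices have degree `r`. -/
def IsRegular {α : Type*} (H : Hypergraph α) (r : ℕ) : Prop :=
  ∀ v ∈ H.vertexSet, H.degree v = r

/-- A hypergraph is `k`-uniform if all its hyperedges have cardinality `k`. -/
def IsUniform {α : Type*} (H : Hypergraph α) (k : ℕ) : Prop :=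
  ∀ e ∈ H.edgeSet, e.encard = k

end Hypergraph

/-- A simple graph regarded as a hypergraph: its hyperedges are the pairs of adjacent vertices. -/
def SimpleGraph.asHypergraph {V : Type*} (G : SimpleGraph V) : Hypergraph V where
  vertexSet := Set.univ
  edgeSet := {e | ∃ u v, G.Adj u v ∧ e = {u, v}}
  subset_vertexSet_of_mem_edgeSet' := fun _ _ => Set.subset_univ _

/-! On the cyclic group of order `n`, the triples T(a) = {a, a+1, a+2} cover every point three
times, and T(a) meets T(a+1) in {a+1, a+2}, an edge of the cycle, while T(a) and T(a+2) share one
point and more distant triples share none. Thus the triples alone already give the cycle, but with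
`n` hyperedges of size 3. To halve their number, T(a) is merged with T(σ a) for an involution σ with
at most one fixed point.

Merging is harmless if σ spreads points: T(σ a) stays away from T(a), T(a+1) and T(a+2) unless σ
fixes a, and a, a+1, a+2 have images with T(σ a) disjoint from T(σ(a+1)) and T(σ(a+2)). Then merged
edges still meet exactly as their nearby triples do (`IsSpread.inter_eq`). If `k` is the number of
hyperedges and `f` ≤ 1 the number of fixed points, then 2k = n + f; parity decides whether there is
an edge of size 3.

Such σ exist for every `n` ≥ 20: explicit tables settle `n` < 40, and gluing on a fixed-point-free
block of length 20 (`IsSpreadNat.append`) does the rest. -/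

section triples

/-! ### Merged triples and their intersections. -/

variable {R : Type*} [CommRing R]

/-- Three consecutive elements. -/
def triple (a : R) : Set R := {a, a + 1, a + 2}

/-- The union of the triples starting at `a` and at `σ a`. -/
def pairedTriple (σ : R → R) (a : R) : Set R := triple a ∪ triple (σ a)

/-- An involution for which the sets `pairedTriple σ a` and `pairedTriple σ b` meet only in the
overlap of two of their triples. -/
structure IsSpread (σ : R → R) : Prop where
  two_ne : (2 : R) ≠ 0
  three_ne : (3 : R) ≠ 0
  four_ne : (4 : R) ≠ 0
  invol : ∀ a, σ (σ a) = a
  far_zero : ∀ a, σ a = a ∨ Disjoint (triple a) (triple (σ a))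
  far_one : ∀ a, σ a = a ∨ Disjoint (triple (a + 1)) (triple (σ a))
  far_two : ∀ a, σ a = a ∨ Disjoint (triple (a + 2)) (triple (σ a))
  step_one : ∀ a, Disjoint (triple (σ a)) (triple (σ (a + 1)))
  step_two : ∀ a, Disjoint (triple (σ a)) (triple (σ (a + 2)))
  fixed_unique : ∀ a b, σ a = a → σ b = b → a = b

theorem mem_triple {a v : R} : v ∈ triple a ↔ v = a ∨ v = a + 1 ∨ v = a + 2 := Iff.rfl

/-- Two triples with a common element start at distance at most two. -/
theorem eq_add_of_mem_triple {a b v : R} (ha : v ∈ triple a) (hb : v ∈ triple b) :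
    a = b ∨ b = a + 1 ∨ b = a + 2 ∨ a = b + 1 ∨ a = b + 2 := by
  rw [mem_triple] at ha hb
  grind

theorem disjoint_triple_add {a b : R} (c : R) (h : Disjoint (triple (a + c)) (triple b)) :
    Disjoint (triple a) (triple (b - c)) := by
  rw [Set.disjoint_left] at h ⊢
  intro v hv hv'
  refine h (a := v + c) ?_ ?_
  · rw [mem_triple] at hv ⊢
    grind
  · rw [mem_triple] at hv' ⊢
    grind

namespace IsSpread

variable {σ : R → R} (h : IsSpread σ)
include h

theorem one_ne : (1 : R) ≠ 0 := by
  intro h1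
  apply h.two_ne
  linear_combination 2 * h1

theorem pairedTriple_apply (a : R) : pairedTriple σ (σ a) = pairedTriple σ a := by
  rw [pairedTriple, pairedTriple, h.invol, Set.union_comm]

theorem encard_triple (a : R) : (triple a).encard = 3 := by
  rw [triple, Set.encard_eq_three]
  refine ⟨a, a + 1, a + 2, fun he => h.one_ne ?_, fun he => h.two_ne ?_,
    fun he => h.one_ne ?_, rfl⟩ <;> linear_combination -he

theorem triple_inter_add_one (a : R) :
    triple a ∩ triple (a + 1) = {a + 1, a + 1 + 1} := by
  ext v
  simp only [Set.mem_inter_iff, mem_triple, Set.mem_insert_iff, Set.mem_singleton_iff]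
  refine ⟨?_, by grind⟩
  rintro ⟨rfl | h1 | h1, h2⟩
  · rcases h2 with h2 | h2 | h2
    · exact absurd (by linear_combination -h2) h.one_ne
    · exact absurd (by linear_combination -h2) h.two_ne
    · exact absurd (by linear_combination -h2) h.three_ne
  · exact .inl h1
  · exact .inr (by linear_combination h1)

theorem triple_inter_add_two (a : R) : triple a ∩ triple (a + 2) = {a + 2} := by
  ext v
  simp only [Set.mem_inter_iff, mem_triple, Set.mem_singleton_iff]
  refine ⟨?_, by grind⟩
  rintro ⟨rfl | rfl | h1, h2⟩
  · rcases h2 with h2 | h2 | h2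
    · exact absurd (by linear_combination -h2) h.two_ne
    · exact absurd (by linear_combination -h2) h.three_ne
    · exact absurd (by linear_combination -h2) h.four_ne
  · rcases h2 with h2 | h2 | h2
    · exact absurd (by linear_combination -h2) h.one_ne
    · exact absurd (by linear_combination -h2) h.two_ne
    · exact absurd (by linear_combination -h2) h.three_ne
  · exact h1

/-- Only the triples at `a` and at `a + d` contribute to the intersection. -/
theorem inter_eq {a d : R} (hf : ∀ a, σ a = a ∨ Disjoint (triple (a + d)) (triple (σ a)))
    (hs : ∀ a, Disjoint (triple (σ a)) (triple (σ (a + d)))) :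
    pairedTriple σ a ∩ pairedTriple σ (a + d) = triple a ∩ triple (a + d) := by
  refine Set.Subset.antisymm ?_ (Set.inter_subset_inter Set.subset_union_left
    Set.subset_union_left)
  rintro v ⟨hv | hv, hw | hw⟩
  · exact ⟨hv, hw⟩
  -- Here v lies in T(a) and T(σ(a+d)). Applying `hf` at σ(a+d) separates T(σ(a+d)+d) from T(a+d),
  -- and translation by -d separates T(σ(a+d)) from T(a).
  · have h0 := hs a
    rcases hf (σ (a + d)) with h1 | h1
    · rw [h.invol] at h1
      rw [← h1] at hw
      exact ⟨hv, hw⟩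
    · rw [h.invol] at h1
      have := disjoint_triple_add _ h1
      rw [add_sub_cancel_right] at this
      exact absurd hv (Set.disjoint_left.1 this hw)
  · rcases hf a with h1 | h1
    · rw [h1] at hv
      exact ⟨hv, hw⟩
    · exact absurd hv (Set.disjoint_left.1 h1 hw)
  · exact absurd hw (Set.disjoint_left.1 (hs a) hv)

theorem inter_add_one (a : R) :
    pairedTriple σ a ∩ pairedTriple σ (a + 1) = {a + 1, a + 1 + 1} := by
  rw [h.inter_eq h.far_one h.step_one, h.triple_inter_add_one]

theorem inter_add_two (a : R) : pairedTriple σ a ∩ pairedTriple σ (a + 2) = {a + 2} := by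
  rw [h.inter_eq h.far_two h.step_two, h.triple_inter_add_two]

theorem ne_add_one (a : R) : pairedTriple σ a ≠ pairedTriple σ (a + 1) := by
  intro he
  have h1 := h.inter_add_one a
  rw [← he, Set.inter_self] at h1
  have h2 : (triple a).encard ≤ (pairedTriple σ a).encard :=
    Set.encard_le_encard Set.subset_union_left
  rw [h1, h.encard_triple] at h2
  exact absurd (h2.trans (Set.encard_insert_le _ _)) (by rw [Set.encard_singleton]; decide)

theorem ne_add_two (a : R) : pairedTriple σ a ≠ pairedTriple σ (a + 2) := by
  intro he
  have h1 := h.inter_add_two a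
  rw [← he, Set.inter_self] at h1
  have h2 : (triple a).encard ≤ (pairedTriple σ a).encard :=
    Set.encard_le_encard Set.subset_union_left
  rw [h1, h.encard_triple, Set.encard_singleton] at h2
  exact absurd h2 (by decide)

theorem exists_of_mem {a v : R} (hv : v ∈ pairedTriple σ a) :
    ∃ b, (b = a ∨ b = σ a) ∧ pairedTriple σ b = pairedTriple σ a ∧ v ∈ triple b := by
  rcases hv with hv | hv
  · exact ⟨a, .inl rfl, rfl, hv⟩
  · exact ⟨σ a, .inr rfl, h.pairedTriple_apply a, hv⟩

/-- Since a lies in the edge of b, it lies in T(c) with c = b or c = σ b, so a and c are at distance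
at most 2. Distances 1 and 2 are impossible: those edges meet in at most two points, but each has at
least three. -/
theorem pairedTriple_eq_iff {a b : R} :
    pairedTriple σ a = pairedTriple σ b ↔ a = b ∨ a = σ b := by
  refine ⟨fun he => ?_, ?_⟩
  · have ha : a ∈ triple a := .inl rfl
    have hm : a ∈ pairedTriple σ b := he ▸ Or.inl ha
    obtain ⟨c, hc, hcb, hac⟩ := h.exists_of_mem hm
    rw [← hcb] at he
    rcases eq_add_of_mem_triple ha hac with h1 | h1 | h1 | h1 | h1
    · rwa [h1]
    · exact absurd he (h1 ▸ h.ne_add_one a)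
    · exact absurd he (h1 ▸ h.ne_add_two a)
    · exact absurd he.symm (h1 ▸ h.ne_add_one c)
    · exact absurd he.symm (h1 ▸ h.ne_add_two c)
  · rintro (rfl | rfl)
    · rfl
    · exact h.pairedTriple_apply b

theorem encard_pairedTriple_of_ne {a : R} (ha : σ a ≠ a) : (pairedTriple σ a).encard = 6 := by
  rw [pairedTriple, Set.encard_union_eq ((h.far_zero a).resolve_left ha), h.encard_triple,
    h.encard_triple]
  norm_num

theorem encard_pairedTriple_of_eq {a : R} (ha : σ a = a) : (pairedTriple σ a).encard = 3 := by
  rw [pairedTriple, ha, Set.union_self, h.encard_triple]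

theorem exists_pair_of_inter {a b : R} (hne : pairedTriple σ a ≠ pairedTriple σ b)
    (hcard : 2 ≤ (pairedTriple σ a ∩ pairedTriple σ b).encard) :
    ∃ u, pairedTriple σ a ∩ pairedTriple σ b = {u, u + 1} := by
  obtain ⟨v, hva, hvb⟩ : (pairedTriple σ a ∩ pairedTriple σ b).Nonempty := by
    rw [← Set.encard_pos]
    exact lt_of_lt_of_le (by decide) hcard
  -- Each edge has two names, a and σ a; choose the one whose own triple contains the common point
  -- v. The new names are then at distance at most 2.
  obtain ⟨a', -, ha, hva'⟩ := h.exists_of_mem hva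
  obtain ⟨b', -, hb, hvb'⟩ := h.exists_of_mem hvb
  rw [← ha, ← hb] at hne hcard ⊢
  rcases eq_add_of_mem_triple hva' hvb' with h1 | rfl | rfl | rfl | rfl
  · exact absurd (congrArg _ h1) hne
  · exact ⟨_, h.inter_add_one a'⟩
  · rw [h.inter_add_two, Set.encard_singleton] at hcard
    exact absurd hcard (by decide)
  · exact ⟨_, by rw [Set.inter_comm]; exact h.inter_add_one b'⟩
  · rw [Set.inter_comm, h.inter_add_two, Set.encard_singleton] at hcard
    exact absurd hcard (by decide)

end IsSpread

/-- The hypergraph with the hyperedges `pairedTriple σ a`. -/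
def tripleHypergraph (σ : R → R) : Hypergraph R where
  vertexSet := Set.univ
  edgeSet := Set.range (pairedTriple σ)
  subset_vertexSet_of_mem_edgeSet' := fun _ _ => Set.subset_univ _

/-! ### Edge intersections, degrees and number of edges. -/

namespace IsSpread

variable {σ : R → R} (h : IsSpread σ)
include h

theorem edgeSet_edgeIntersection :
    (tripleHypergraph σ).edgeIntersection.edgeSet = {e | ∃ u, e = {u, u + 1}} := by
  ext e
  constructor
  · rintro ⟨_, ⟨a, rfl⟩, _, ⟨b, rfl⟩, hne, hcard, rfl⟩
    exact h.exists_pair_of_inter hne hcard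
  · rintro ⟨u, rfl⟩
    have h1 := h.inter_add_one (u - 1)
    rw [sub_add_cancel] at h1
    refine ⟨_, ⟨u - 1, rfl⟩, _, ⟨u, rfl⟩, ?_, ?_, h1.symm⟩
    · simpa using h.ne_add_one (u - 1)
    · rw [h1, Set.encard_pair]
      simpa using h.one_ne

theorem isRegular : (tripleHypergraph σ).IsRegular 3 := by
  intro v _
  have hset : {e | e ∈ (tripleHypergraph σ).edgeSet ∧ v ∈ e} =
      {pairedTriple σ v, pairedTriple σ (v - 1), pairedTriple σ (v - 2)} := by
    ext e
    constructor
    · rintro ⟨⟨a, rfl⟩, hv⟩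
      obtain ⟨b, -, hb, hvb⟩ := h.exists_of_mem hv
      rw [← hb]
      rcases hvb with rfl | rfl | rfl
      · exact .inl rfl
      · exact .inr (.inl (by rw [add_sub_cancel_right]))
      · exact .inr (.inr (by rw [add_sub_cancel_right]; rfl))
    · rintro (rfl | rfl | rfl)
      · exact ⟨⟨_, rfl⟩, .inl (.inl rfl)⟩
      · exact ⟨⟨_, rfl⟩, .inl (.inr (.inl (by ring)))⟩
      · exact ⟨⟨_, rfl⟩, .inl (.inr (.inr (by
          rw [Set.mem_singleton_iff]; ring)))⟩
  rw [Hypergraph.degree, hset, Nat.cast_ofNat, Set.encard_eq_three]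
  refine ⟨_, _, _, ?_, ?_, ?_, rfl⟩
  · simpa using (h.ne_add_one (v - 1)).symm
  · simpa using (h.ne_add_two (v - 2)).symm
  · have := (h.ne_add_one (v - 2)).symm
    rwa [show v - 2 + 1 = v - 1 by ring] at this

/-- Counting the hyperedges together with the fixed points counts every `a` twice. -/
theorem two_mul_encard_edgeSet [Fintype R] [LinearOrder R] :
    ∃ k f : ℕ, (tripleHypergraph σ).edgeSet.encard = k ∧ 2 * k = Fintype.card R + f ∧ f ≤ 1 ∧
      (f = 0 → ∀ a, σ a ≠ a) ∧ (f ≠ 0 → ∃ a, σ a = a) := by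
  classical
  -- The order, unrelated to the ring structure, only selects a representative of each orbit {a, σ
  -- a}.
  let A : Finset R := {a | a ≤ σ a}
  let B : Finset R := {a | σ a ≤ a}
  let F : Finset R := {a | σ a = a}
  have hAB : A.card = B.card := by
    refine Finset.card_nbij' σ σ ?_ ?_ (fun a _ => h.invol a) (fun a _ => h.invol a)
    · intro a ha
      simpa [A, B, h.invol] using ha
    · intro a ha
      simpa [A, B, h.invol] using ha
  have hunion : A ∪ B = Finset.univ := by
    ext a
    simpa [A, B] using le_total a (σ a)
  have hinter : A ∩ B = F := by
    ext a
    simp only [A, B, F, Finset.mem_inter, Finset.mem_filter_univ]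
    exact ⟨fun ⟨h1, h2⟩ => le_antisymm h2 h1, fun h1 => ⟨h1.ge, h1.le⟩⟩
  have hcount := Finset.card_union_add_card_inter A B
  rw [hunion, hinter, Finset.card_univ, ← hAB] at hcount
  refine ⟨A.card, F.card, ?_, by omega, ?_, ?_, ?_⟩
  · have himage : (tripleHypergraph σ).edgeSet = pairedTriple σ '' (A : Set R) := by
      refine Set.Subset.antisymm ?_ (Set.image_subset_range _ _)
      rintro _ ⟨a, rfl⟩
      rcases le_total a (σ a) with ha | ha
      · exact ⟨a, by simpa [A] using ha, rfl⟩
      · exact ⟨σ a, by simpa [A, h.invol] using ha, h.pairedTriple_apply a⟩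
    have hinj : Set.InjOn (pairedTriple σ) (A : Set R) := by
      intro a ha b hb he
      rcases h.pairedTriple_eq_iff.1 he with h1 | h1
      · exact h1
      · have ha' : a ≤ σ a := by simpa [A] using ha
        have hb' : b ≤ σ b := by simpa [A] using hb
        rw [h1, h.invol] at ha'
        rw [h1]
        exact le_antisymm ha' hb'
    rw [himage, hinj.encard_image, Set.encard_coe_eq_coe_finsetCard]
  · rw [Finset.card_le_one]
    intro a ha b hb
    exact h.fixed_unique a b (by simpa [F] using ha) (by simpa [F] using hb)
  · intro h0 a ha
    rw [Finset.card_eq_zero] at h0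
    exact Finset.notMem_empty a (h0 ▸ by simpa [F] using ha)
  · intro h0
    obtain ⟨a, ha⟩ := Finset.card_ne_zero.1 h0
    exact ⟨a, by simpa [F] using ha⟩

end IsSpread

end triples

/-! ### Existence of spread involutions. -/

section cyclic

/-- The positions `x` and `y` on the cycle of length `n` have distance at least `k`. -/
def CycFar (k n x y : ℕ) : Prop :=
  (x + k ≤ y ∨ y + k ≤ x) ∧ y + k ≤ x + n ∧ x + k ≤ y + n

instance (k n x y : ℕ) : Decidable (CycFar k n x y) :=
  inferInstanceAs (Decidable (_ ∧ _))

/-- An involution of `{0, ..., n - 1}` with at most one fixed point that moves the other points by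
at least five, and separates points at distance at most two. -/
structure IsSpreadNat (n : ℕ) (σ : ℕ → ℕ) : Prop where
  lt : ∀ i < n, σ i < n
  invol : ∀ i < n, σ (σ i) = i
  -- 5 = 2 + 3: a shift by at most 2 still leaves the distance 3 that makes triples disjoint.
  far : ∀ i < n, σ i = i ∨ CycFar 5 n i (σ i)
  step_one : ∀ i < n, CycFar 3 n (σ i) (σ ((i + 1) % n))
  step_two : ∀ i < n, CycFar 3 n (σ i) (σ ((i + 2) % n))
  fixed_unique : ∀ i < n, ∀ j < n, σ i = i → σ j = j → i = j
  -- These boundary conditions serve gluing: images of points next to a seam keep away from the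
  -- block ends, hence from one another across either seam.
  zero : 2 ≤ σ 0 ∧ σ 0 + 3 ≤ n
  one : 2 ≤ σ 1 ∧ σ 1 + 3 ≤ n
  sub_two : 2 ≤ σ (n - 2) ∧ σ (n - 2) + 3 ≤ n
  sub_one : 2 ≤ σ (n - 1) ∧ σ (n - 1) + 3 ≤ n

/-- All quantifiers are bounded here, which makes the condition decidable and the tables checkable
by evaluation. -/
theorem isSpreadNat_iff (n : ℕ) (σ : ℕ → ℕ) : IsSpreadNat n σ ↔
    (∀ i < n, σ i < n ∧ σ (σ i) = i ∧ (σ i = i ∨ CycFar 5 n i (σ i)) ∧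
      CycFar 3 n (σ i) (σ ((i + 1) % n)) ∧ CycFar 3 n (σ i) (σ ((i + 2) % n)) ∧
      ∀ j < n, σ i = i → σ j = j → i = j) ∧
    ∀ i ∈ [0, 1, n - 2, n - 1], 2 ≤ σ i ∧ σ i + 3 ≤ n := by
  constructor
  · intro h
    refine ⟨fun i hi => ⟨h.lt i hi, h.invol i hi, h.far i hi, h.step_one i hi, h.step_two i hi,
      h.fixed_unique i hi⟩, ?_⟩
    simpa using ⟨h.zero, h.one, h.sub_two, h.sub_one⟩
  · rintro ⟨h, he⟩
    exact ⟨fun i hi => (h i hi).1, fun i hi => (h i hi).2.1, fun i hi => (h i hi).2.2.1,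
      fun i hi => (h i hi).2.2.2.1, fun i hi => (h i hi).2.2.2.2.1,
      fun i hi => (h i hi).2.2.2.2.2, he _ (by simp), he _ (by simp), he _ (by simp),
      he _ (by simp)⟩

instance (n : ℕ) (σ : ℕ → ℕ) : Decidable (IsSpreadNat n σ) :=
  decidable_of_iff' _ (isSpreadNat_iff n σ)

/-- Two involutions side by side, of which the second has no fixed point. -/
theorem IsSpreadNat.append {a b : ℕ} {σ τ : ℕ → ℕ} (ha : 20 ≤ a) (hb : 20 ≤ b)
    (hσ : IsSpreadNat a σ) (hτ : IsSpreadNat b τ) (hfix : ∀ i < b, τ i ≠ i) :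
    IsSpreadNat (a + b) fun i => if i < a then σ i else a + τ (i - a) := by
  have step : ∀ d, d = 1 ∨ d = 2 →
      (∀ i < a, CycFar 3 a (σ i) (σ ((i + d) % a))) →
      (∀ i < b, CycFar 3 b (τ i) (τ ((i + d) % b))) → ∀ i < a + b,
      CycFar 3 (a + b) (if i < a then σ i else a + τ (i - a))
        (if (i + d) % (a + b) < a then σ ((i + d) % (a + b))
          else a + τ ((i + d) % (a + b) - a)) := by
    intro d hd h1 h2 i hi
    have z1 := hσ.zero
    have z2 := hσ.one
    have z3 := hσ.sub_two
    have z4 := hσ.sub_one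
    have w1 := hτ.zero
    have w2 := hτ.one
    have w3 := hτ.sub_two
    have w4 := hτ.sub_one
    rcases lt_or_ge (i + d) a with h | h
    · have h3 := h1 i (by omega)
      rw [Nat.mod_eq_of_lt h] at h3
      rw [Nat.mod_eq_of_lt (by omega : i + d < a + b), if_pos h, if_pos (by omega)]
      unfold CycFar at h3 ⊢
      omega
    rcases lt_or_ge i a with h' | h'
    · rw [Nat.mod_eq_of_lt (by omega : i + d < a + b), if_pos h', if_neg (by omega)]
      -- Crossing the seam: the images are at most a - 3 and at least a + 2.
      have hi' : i = a - 1 ∨ i = a - 2 := by omega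
      have hj : i + d - a = 0 ∨ i + d - a = 1 := by omega
      unfold CycFar
      rcases hi' with e | e <;> rcases hj with e' | e' <;> rw [e', e] <;> omega
    rcases lt_or_ge (i + d) (a + b) with h'' | h''
    · have h3 := h2 (i - a) (by omega)
      rw [Nat.mod_eq_of_lt (by omega : i - a + d < b),
        (by omega : i - a + d = i + d - a)] at h3
      rw [Nat.mod_eq_of_lt h'', if_neg (by omega), if_neg (by omega)]
      unfold CycFar at h3 ⊢
      omega
    · rw [Nat.mod_eq_sub_mod h'', Nat.mod_eq_of_lt (by omega : i + d - (a + b) < a + b),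
        if_neg (by omega), if_pos (by omega)]
      have hi' : i - a = b - 1 ∨ i - a = b - 2 := by omega
      have hj : i + d - (a + b) = 0 ∨ i + d - (a + b) = 1 := by omega
      unfold CycFar
      rcases hi' with e | e <;> rcases hj with e' | e' <;> rw [e', e] <;> omega
  refine ⟨?_, ?_, ?_, step 1 (.inl rfl) hσ.step_one hτ.step_one,
    step 2 (.inr rfl) hσ.step_two hτ.step_two, ?_, ?_, ?_, ?_, ?_⟩
  · intro i hi
    split_ifs with h
    · have := hσ.lt i h
      omega
    · have := hτ.lt (i - a) (by omega)
      omega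
  · intro i hi
    by_cases h : i < a
    · rw [if_pos h, if_pos (hσ.lt i h), hσ.invol i h]
    · rw [if_neg h, if_neg (by omega), Nat.add_sub_cancel_left, hτ.invol _ (by omega)]
      omega
  · intro i hi
    split_ifs with h
    · have := hσ.far i h
      unfold CycFar at this ⊢
      omega
    · have := hτ.far (i - a) (by omega)
      unfold CycFar at this ⊢
      omega
  · intro i hi j hj
    have hi' := hfix (i - a)
    have hj' := hfix (j - a)
    split_ifs with h h' h'
    · exact hσ.fixed_unique i h j h'
    all_goals omega
  · have := hσ.zero
    rw [if_pos (by omega)]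
    omega
  · have := hσ.one
    rw [if_pos (by omega)]
    omega
  · have := hτ.sub_two
    rw [if_neg (by omega), (by omega : a + b - 2 - a = b - 2)]
    omega
  · have := hτ.sub_one
    rw [if_neg (by omega), (by omega : a + b - 1 - a = b - 1)]
    omega

theorem exists_isSpreadNat_twenty : ∃ σ, IsSpreadNat 20 σ ∧ ∀ i < 20, σ i ≠ i :=
  -- The list has as many entries as the cycle has points, so the default 0 is never read below 20.
  ⟨fun i => [5, 8, 12, 16, 9, 0, 13, 17, 1, 4, 15, 18, 2, 6, 19, 10, 3, 7, 11, 14].getD i 0, by decide +kernel⟩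

theorem exists_isSpreadNat_of_lt (n : ℕ) (hn : 20 ≤ n) (hn' : n < 40) :
    ∃ σ, IsSpreadNat n σ := by
  interval_cases n
  · exact ⟨fun i => [5, 8, 12, 16, 9, 0, 13, 17, 1, 4, 15, 18, 2, 6, 19, 10, 3, 7, 11, 14].getD i 0,
      by decide +kernel⟩
  · exact ⟨fun i => [5, 8, 11, 14, 17, 0, 12, 15, 1, 19, 16, 2, 6, 20, 3, 7, 10, 4, 18, 9, 13].getD i 0,
      by decide +kernel⟩
  · exact ⟨fun i => [5, 8, 11, 14, 17, 0, 12, 18, 1, 15, 19, 2, 6, 20, 3, 9, 21, 4, 7, 10, 13, 16].getD i 0,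
      by decide +kernel⟩
  · exact ⟨fun i => [5, 8, 11, 14, 17, 0, 12, 15, 1, 18, 21, 2, 6, 19, 3, 7, 22, 4, 9, 13, 20, 10, 16].getD i 0,
      by decide +kernel⟩
  · exact ⟨fun i => [5, 8, 11, 14, 17, 0, 12, 20, 1, 16, 21, 2, 6, 19, 3, 22, 9, 4, 23, 13, 7, 10, 15, 18].getD i 0,
      by decide +kernel⟩
  · exact ⟨fun i => [5, 8, 11, 14, 17, 0, 12, 15, 1, 18, 21, 2, 6, 20, 3, 7, 23, 4, 9, 24, 13, 10, 22, 16, 19].getD i 0,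
      by decide +kernel⟩
  · exact ⟨fun i => [5, 8, 11, 14, 17, 0, 12, 18, 1, 23, 20, 2, 6, 21, 3, 25, 22, 4, 7, 24, 10, 13, 16, 9,
      19, 15].getD i 0,
      by decide +kernel⟩
  · exact ⟨fun i => [5, 8, 11, 14, 17, 0, 12, 15, 1, 19, 23, 2, 6, 20, 3, 7, 22, 4, 25, 9, 13, 26, 16, 10,
      24, 18, 21].getD i 0,
      by decide +kernel⟩
  · exact ⟨fun i => [5, 8, 11, 14, 17, 0, 12, 16, 1, 20, 24, 2, 6, 21, 3, 25, 7, 4, 23, 26, 9, 13, 27, 18,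
      10, 15, 19, 22].getD i 0,
      by decide +kernel⟩
  · exact ⟨fun i => [5, 8, 11, 14, 17, 0, 12, 15, 1, 18, 21, 2, 6, 22, 3, 7, 25, 4, 9, 24, 27, 10, 13, 28,
      19, 16, 26, 20, 23].getD i 0,
      by decide +kernel⟩
  · exact ⟨fun i => [5, 8, 11, 14, 17, 0, 12, 18, 1, 21, 24, 2, 6, 25, 3, 22, 27, 4, 7, 26, 29, 9, 15, 28,
      10, 13, 19, 16, 23, 20].getD i 0,
      by decide +kernel⟩
  · exact ⟨fun i => [5, 8, 11, 14, 17, 0, 12, 15, 1, 19, 22, 2, 6, 23, 3, 7, 26, 4, 29, 9, 25, 28, 10, 13,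
      30, 20, 16, 27, 21, 18, 24].getD i 0,
      by decide +kernel⟩
  · exact ⟨fun i => [5, 8, 11, 14, 17, 0, 12, 15, 1, 20, 23, 2, 6, 26, 3, 7, 29, 4, 24, 27, 9, 31, 28, 10,
      18, 30, 13, 19, 22, 16, 25, 21].getD i 0,
      by decide +kernel⟩
  · exact ⟨fun i => [5, 8, 11, 14, 17, 0, 12, 15, 1, 18, 21, 2, 6, 22, 3, 7, 25, 4, 9, 26, 29, 10, 13, 28,
      31, 16, 19, 32, 23, 20, 30, 24, 27].getD i 0,
      by decide +kernel⟩
  · exact ⟨fun i => [5, 8, 11, 14, 17, 0, 12, 15, 1, 18, 22, 2, 6, 25, 3, 7, 29, 4, 9, 26, 30, 33, 10, 28,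
      31, 13, 19, 32, 23, 16, 20, 24, 27, 21].getD i 0,
      by decide +kernel⟩
  · exact ⟨fun i => [5, 8, 11, 14, 17, 0, 12, 15, 1, 18, 21, 2, 6, 23, 3, 7, 24, 4, 9, 27, 31, 10, 28, 13,
      16, 30, 33, 19, 22, 34, 25, 20, 32, 26, 29].getD i 0,
      by decide +kernel⟩
  · exact ⟨fun i => [5, 8, 11, 14, 17, 0, 12, 15, 1, 18, 21, 2, 6, 24, 3, 7, 25, 4, 9, 28, 32, 10, 29, 33,
      13, 16, 31, 34, 19, 22, 35, 26, 20, 23, 27, 30].getD i 0,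
      by decide +kernel⟩
  · exact ⟨fun i => [5, 8, 11, 14, 17, 0, 12, 15, 1, 18, 21, 2, 6, 19, 3, 7, 25, 4, 9, 13, 28, 10, 32, 29,
      35, 16, 31, 34, 20, 23, 36, 26, 22, 33, 27, 24, 30].getD i 0,
      by decide +kernel⟩
  · exact ⟨fun i => [31, 8, 12, 30, 19, 33, 26, 15, 1, 35, 24, 32, 2, 37, 29, 7, 21, 28, 25, 4, 36, 16, 27,
      34, 10, 18, 6, 22, 17, 14, 3, 0, 11, 5, 23, 9, 20, 13].getD i 0,
      by decide +kernel⟩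
  · exact ⟨fun i => [5, 8, 11, 14, 17, 0, 12, 15, 1, 18, 21, 2, 6, 19, 3, 7, 23, 4, 9, 13, 27, 10, 30, 16,
      34, 31, 37, 20, 33, 36, 22, 25, 38, 28, 24, 35, 29, 26, 32].getD i 0,
      by decide +kernel⟩

theorem exists_isSpreadNat (n : ℕ) (hn : 20 ≤ n) : ∃ σ, IsSpreadNat n σ := by
  induction n using Nat.strong_induction_on with
  | _ n ih =>
    rcases lt_or_ge n 40 with h | h
    · exact exists_isSpreadNat_of_lt n hn h
    · obtain ⟨σ, hσ⟩ := ih (n - 20) (by omega) (by omega)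
      obtain ⟨τ, hτ, hfix⟩ := exists_isSpreadNat_twenty
      have := hσ.append (by omega) le_rfl hτ hfix
      rw [Nat.sub_add_cancel (by omega)] at this
      exact ⟨_, this⟩

end cyclic

/-! ### Transfer to the cyclic group `Fin n` and conclusion. -/

section fin

open Fin.CommRing

theorem val_add_natCast {n : ℕ} [NeZero n] (x : Fin n) {k : ℕ} (hk : k < n) :
    (x + (k : Fin n)).val = if n ≤ x.val + k then x.val + k - n else x.val + k := by
  rw [Fin.val_add_eq_ite, Fin.val_cast_of_lt hk]

/-- The offsets differ by less than k, too little to close a cyclic gap of at least k. -/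
theorem CycFar.add_natCast_ne {n k s t : ℕ} [NeZero n] {x y : Fin n}
    (h : CycFar k n x.val y.val) (hs : s < k) (ht : t < k) :
    x + (s : Fin n) ≠ y + (t : Fin n) := by
  intro he
  have he' := congrArg Fin.val he
  have hx := x.isLt
  have hy := y.isLt
  unfold CycFar at h
  rw [val_add_natCast x (by omega), val_add_natCast y (by omega)] at he'
  split_ifs at he' <;> omega

theorem exists_of_mem_triple {R : Type*} [CommRing R] {a v : R} (h : v ∈ triple a) :
    ∃ s : ℕ, s < 3 ∧ v = a + (s : R) := by
  rcases h with rfl | rfl | rfl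
  · exact ⟨0, by simp⟩
  · exact ⟨1, by simp⟩
  · exact ⟨2, by simp⟩

theorem CycFar.disjoint_triple {n d k : ℕ} [NeZero n] {x y : Fin n} (hd : d + 3 ≤ k)
    (h : CycFar k n x.val y.val) : Disjoint (triple (x + (d : Fin n))) (triple y) := by
  rw [Set.disjoint_left]
  intro v hv hv'
  obtain ⟨s, hs, rfl⟩ := exists_of_mem_triple hv
  obtain ⟨t, ht, he⟩ := exists_of_mem_triple hv'
  rw [add_assoc, ← Nat.cast_add] at he
  exact h.add_natCast_ne (by omega) (by omega) he

theorem IsSpreadNat.isSpread {n : ℕ} [NeZero n] (hn : 20 ≤ n) {σ : ℕ → ℕ}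
    (h : IsSpreadNat n σ) :
    IsSpread fun i : Fin n => (⟨σ i.val, h.lt i.val i.isLt⟩ : Fin n) := by
  have cast_ne : ∀ k : ℕ, 0 < k → k < 20 → (k : Fin n) ≠ 0 := by
    intro k hk hk' he
    have := congrArg Fin.val he
    rw [Fin.val_cast_of_lt (by omega), Fin.val_zero] at this
    omega
  have val_add : ∀ (a : Fin n) (k : ℕ), k < 20 → (a + (k : Fin n)).val = (a.val + k) % n := by
    intro a k hk
    rw [Fin.val_add, Fin.val_cast_of_lt (by omega)]
  have far : ∀ d : ℕ, d ≤ 2 → ∀ a : Fin n, (⟨σ a.val, h.lt a.val a.isLt⟩ : Fin n) = a ∨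
      Disjoint (triple (a + (d : Fin n))) (triple (⟨σ a.val, h.lt a.val a.isLt⟩ : Fin n)) := by
    intro d hd a
    rcases h.far a.val a.isLt with h1 | h1
    · exact .inl (Fin.ext h1)
    · exact .inr (CycFar.disjoint_triple (k := 5) (by omega) h1)
  refine ⟨by exact_mod_cast cast_ne 2 (by omega) (by omega),
    by exact_mod_cast cast_ne 3 (by omega) (by omega),
    by exact_mod_cast cast_ne 4 (by omega) (by omega),
    fun a => Fin.ext (h.invol a.val a.isLt),
    by simpa using far 0 (by omega), by simpa using far 1 (by omega),
    by simpa using far 2 (by omega), fun a => ?_, fun a => ?_,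
    fun a b ha hb => Fin.ext (h.fixed_unique a.val a.isLt b.val b.isLt
      (congrArg Fin.val ha) (congrArg Fin.val hb))⟩
  · have h1 := h.step_one a.val a.isLt
    rw [← val_add a 1 (by omega)] at h1
    simpa using CycFar.disjoint_triple (n := n) (d := 0) (k := 3) (x := ⟨_, h.lt _ a.isLt⟩)
      (y := ⟨_, h.lt _ (a + ((1 : ℕ) : Fin n)).isLt⟩) le_rfl h1
  · have h1 := h.step_two a.val a.isLt
    rw [← val_add a 2 (by omega)] at h1
    simpa using CycFar.disjoint_triple (n := n) (d := 0) (k := 3) (x := ⟨_, h.lt _ a.isLt⟩)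
      (y := ⟨_, h.lt _ (a + ((2 : ℕ) : Fin n)).isLt⟩) le_rfl h1

theorem edgeSet_cycleGraph_asHypergraph (m : ℕ) :
    (SimpleGraph.cycleGraph (m + 2)).asHypergraph.edgeSet =
      {e | ∃ u : Fin (m + 2), e = {u, u + 1}} := by
  ext e
  constructor
  · rintro ⟨u, v, huv, rfl⟩
    rw [SimpleGraph.cycleGraph_adj] at huv
    rcases huv with h | h
    · exact ⟨v, by rw [← h, add_sub_cancel, Set.pair_comm]⟩
    · exact ⟨u, by rw [← h, add_sub_cancel]⟩
  · rintro ⟨u, rfl⟩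
    exact ⟨u, u + 1, SimpleGraph.cycleGraph_adj.2 (.inr (by rw [add_sub_cancel_left])), rfl⟩

/-- A spread involution of `{0, ..., n - 1}` yields a hypergraph whose edge intersection
hypergraph is the cycle. -/
theorem IsSpreadNat.exists_hypergraph {n : ℕ} {σ : ℕ → ℕ} (hσ : IsSpreadNat n σ)
    (hn : 20 ≤ n) :
    ∃ H : Hypergraph (Fin n),
      H.edgeIntersection = (SimpleGraph.cycleGraph n).asHypergraph ∧
      (Even n → H.IsRegular 3 ∧ H.IsUniform 6 ∧ H.edgeSet.encard = (n / 2 : ℕ)) ∧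
      (Odd n → H.IsRegular 3 ∧ H.edgeSet.encard = ((n + 1) / 2 : ℕ) ∧
        ∃ e ∈ H.edgeSet, e.encard = 3 ∧ ∀ f ∈ H.edgeSet, f ≠ e → f.encard = 6) := by
  obtain ⟨m, rfl⟩ : ∃ m, n = m + 2 := ⟨n - 2, by omega⟩
  have h := hσ.isSpread (by omega)
  obtain ⟨k, f, hk, hkf, hf, hf0, hf1⟩ := h.two_mul_encard_edgeSet
  rw [Fintype.card_fin] at hkf
  refine ⟨_, Hypergraph.ext rfl ?_, fun hn => ⟨h.isRegular, ?_, ?_⟩,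
    fun hn => ⟨h.isRegular, ?_, ?_⟩⟩
  · rw [h.edgeSet_edgeIntersection, edgeSet_cycleGraph_asHypergraph]
  · rintro _ ⟨a, rfl⟩
    -- From 2k = n + f with f ≤ 1, an even cycle length forces f = 0.
    exact h.encard_pairedTriple_of_ne (hf0 (by grind) a)
  · rw [hk]
    congr 1
    grind
  · rw [hk]
    congr 1
    grind
  · obtain ⟨a, ha⟩ := hf1 (by grind)
    refine ⟨_, ⟨a, rfl⟩, h.encard_pairedTriple_of_eq ha, ?_⟩
    rintro _ ⟨b, rfl⟩ hb
    refine h.encard_pairedTriple_of_ne fun hb' => hb ?_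
    rw [h.fixed_unique a b ha hb']

end fin

theorem theorem2 (n : ℕ) (hn : 24 ≤ n) :
    ∃ H : Hypergraph (Fin n),
      H.edgeIntersection = (SimpleGraph.cycleGraph n).asHypergraph ∧
      (Even n → H.IsRegular 3 ∧ H.IsUniform 6 ∧ H.edgeSet.encard = (n / 2 : ℕ)) ∧
      (Odd n → H.IsRegular 3 ∧ H.edgeSet.encard = ((n + 1) / 2 : ℕ) ∧
        ∃ e ∈ H.edgeSet, e.encard = 3 ∧ ∀ f ∈ H.edgeSet, f ≠ e → f.encard = 6) := by
  obtain ⟨σ, hσ⟩ := exists_isSpreadNat n (by omega)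
  exact hσ.exists_hypergraph (by omega)
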